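/- All systems are finite-dimensional with a fixed computational basis, and logarithms are to base $2$. **Allowed operations.** Finitely many parties each hold one system. $\mathrm{CLODCC}$ is the class of operations generated by local unitaries and by sending a tensor factor of one party's system to another party through the dephasing channel, which deletes the off-diagonal terms of the sent factor in its computational basis. No ancillas are added, nothing is discarded, and infinite compositions, in the form of pointwise limits, are included. Write $\mathrm{CLODCC}(A:C:B)$ for this class with three parties $A,C,B$, any two of which may communicate, and $\mathrm{CLODCC}(C:AB)$ for the class with the two parties $C$ and $AB$. **Local idits.** A local idit with $m=\log d$ bits at Alice, where $d\ge 1$ is an integer, is a state $$\alpha_m=\sum_{i,j=0}^{d-1}\tfrac1d\,|i\rangle\langle j|_{A}\otimes U_i\,\sigma_{A'B'}\,U_j^\dagger$$ with $\sigma_{A'B'}$ a state and $U_0,\dots,U_{d-1}$ unitaries on $A'B'$; Alice holds the key system and $A'$, Bob holds $B'$. **Repeater rate.** For a state $\omega$ on $ACB$ let $$\mathcal R_A^{A\leftrightarrow C\leftrightarrow B}(\omega)=\inf_{\epsilon>0}\ \limsup_{n\to\infty}\ \sup\Big\{\tfrac mn:\ \Lambda_n\in\mathrm{CLODCC}(A^n:C^n:B^n),\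 \big\|\mathrm{Tr}_C\Lambda_n(\omega^{\otimes n})-\alpha_m\big\|_1\le\epsilon\Big\},$$ where the supremum runs over all $\Lambda_n$ and all local idits $\alpha_m$ on the output systems of Alice and Bob. **Measured relative entropy.** For a state $\omega$ on $ACB$ let $$D_{C\leftrightarrow AB}(\omega)=\sup_{M}\, D\Big(M(\omega)\,\Big\|\,M\big(\tfrac{\mathbb I}{|ACB|}\big)\Big),$$ where $M$ runs over the measurements consisting of an operation in $\mathrm{CLODCC}(C:AB)$ followed by a readout of all systems in the computational basis, and $D$ is the Kullback--Leibler relative entropy of the outcome distributions. Let $$D^\infty_{C\leftrightarrow AB}(\omega)=\lim_{n\to\infty}\frac1n D_{C\leftrightarrow AB}(\omega^{\otimes n}).$$ **Theorem.** For all states $\rho_{AC_1}$ and $\tilde\rho_{C_2B}$, with $C=C_1C_2$, the limit defining $D^\infty_{C\leftrightarrow AB}(\rho_{AC_1}\otimes\tilde\rho_{C_2B})$ exists, and $$\mathcal R_A^{A\leftrightarrow C\leftrightarrow B}(\rho_{AC_1}\otimes\tilde\rho_{C_2B})\ \le\ D^\infty_{C\leftrightarrow AB}(\rho_{AC_1}\otimes\tilde\rho_{C_2B}).$$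 -/

import Mathlib

open scoped Matrix Kronecker Topology ComplexOrder
open Filter

noncomputable section

/-- A finite-dimensional quantum system, given by the labels of its computational basis. -/
structure QSystem where
  Basis : Type
  [instFintype : Fintype Basis]
  [instDecidableEq : DecidableEq Basis]

namespace QSystem

instance : CoeSort QSystem Type := ⟨QSystem.Basis⟩

attribute [instance] QSystem.instFintype QSystem.instDecidableEq

/-- The composite system `A ⊗ S`. -/
abbrev tensor (A S : QSystem) : QSystem := ⟨A × S⟩

/-- `n` copies of the system `A`. -/
abbrev power (A : QSystem) (n : ℕ) : QSystem := ⟨Fin n → A⟩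

/-- The `d`-dimensional system with computational basis `|0⟩, …, |d-1⟩`. -/
abbrev qudit (d : ℕ) : QSystem := ⟨Fin d⟩

end QSystem

/-- Density operators (states), as matrices in the computational basis. -/
def IsDensity {X : Type} [Fintype X] (ρ : Matrix X X ℂ) : Prop :=
  ρ.PosSemidef ∧ ρ.trace = 1

/-- The maximally mixed state. -/
def maximallyMixed (X : Type) [Fintype X] [DecidableEq X] : Matrix X X ℂ :=
  ((Fintype.card X : ℂ)⁻¹) • (1 : Matrix X X ℂ)

/-- The trace norm `Tr √(M† M)`, i.e. the sum of the singular values of `M`. -/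
def traceNorm {X : Type} [Fintype X] [DecidableEq X] (M : Matrix X X ℂ) : ℝ :=
  ∑ i, Real.sqrt ((Matrix.isHermitian_conjTranspose_mul_self M).eigenvalues i)

/-! ### Closed local operations and communication through a dephasing channel -/

/-- `U` is a unitary identification of the system `A` with the system `A'`. -/
def IsUnitaryBetween {A A' : QSystem} (U : Matrix A' A ℂ) : Prop :=
  Uᴴ * U = 1 ∧ U * Uᴴ = 1

/-- `M ↦ V M V†`. -/
def conjBy {X Y : Type} [Fintype X] (V : Matrix Y X ℂ) (M : Matrix X X ℂ) : Matrix Y Y ℂ :=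
  V * M * Vᴴ

/-- Regrouping of the global system along the relabelling `e` of basis vectors, together with
complete dephasing of the register `s` in its computational basis. -/
def dephasedTransfer {X Y S : Type} [DecidableEq S] (e : Y → X) (s : Y → S)
    (M : Matrix X X ℂ) : Matrix Y Y ℂ :=
  Matrix.of fun x y => if s x = s y then M (e x) (e y) else 0

/-- The class `CLODCC(X : Y)` for two parties: all operations generated by
local unitaries and by sending a subsystem `S` of one party to the other through the dephasing
channel. A local unitary may relabel the basis, so that it can single out any tensor factor
of a lab. No ancilla is added and nothing is discarded.
The constructor `limit` accounts for infinite compositions. -/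
inductive CLODCC₂ (X Y : QSystem) :
    (X' Y' : QSystem) → (Matrix (X × Y) (X × Y) ℂ → Matrix (X' × Y') (X' × Y') ℂ) → Prop
  | id : CLODCC₂ X Y X Y (fun M => M)
  | unitaryX {X' Y' X'' : QSystem} {Φ} (U : Matrix X'' X' ℂ) (hU : IsUnitaryBetween U)
      (h : CLODCC₂ X Y X' Y' Φ) :
      CLODCC₂ X Y X'' Y' (fun M => conjBy (U ⊗ₖ (1 : Matrix Y' Y' ℂ)) (Φ M))
  | unitaryY {X' Y' Y'' : QSystem} {Φ} (U : Matrix Y'' Y' ℂ) (hU : IsUnitaryBetween U)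
      (h : CLODCC₂ X Y X' Y' Φ) :
      CLODCC₂ X Y X' Y'' (fun M => conjBy ((1 : Matrix X' X' ℂ) ⊗ₖ U) (Φ M))
  | sendXY {X' Y' S : QSystem} {Φ} (h : CLODCC₂ X Y (X'.tensor S) Y' Φ) :
      CLODCC₂ X Y X' (Y'.tensor S) (fun M =>
        dephasedTransfer (fun z : X' × (Y' × S) => ((z.1, z.2.2), z.2.1))
          (fun z => z.2.2) (Φ M))
  | sendYX {X' Y' S : QSystem} {Φ} (h : CLODCC₂ X Y X' (Y'.tensor S) Φ) :
      CLODCC₂ X Y (X'.tensor S) Y' (fun M =>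
        dephasedTransfer (fun z : (X' × S) × Y' => (z.1.1, (z.2, z.1.2)))
          (fun z => z.1.2) (Φ M))
  | limit {X' Y' : QSystem} {Φ}
      (Φs : ℕ → Matrix (X × Y) (X × Y) ℂ → Matrix (X' × Y') (X' × Y') ℂ)
      (h : ∀ k, CLODCC₂ X Y X' Y' (Φs k))
      (hlim : ∀ M, Tendsto (fun k => Φs k M) atTop (𝓝 (Φ M))) :
      CLODCC₂ X Y X' Y' Φ

/-- The class `CLODCC(A : C : B)` for three parties, where each pair of parties is connected
by a dephasing channel. The global system is ordered as `A ⊗ C ⊗ B`. -/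
inductive CLODCC₃ (A C B : QSystem) :
    (A' C' B' : QSystem) →
    (Matrix (A × C × B) (A × C × B) ℂ → Matrix (A' × C' × B') (A' × C' × B') ℂ) → Prop
  | id : CLODCC₃ A C B A C B (fun M => M)
  | unitaryA {A' C' B' A'' : QSystem} {Φ} (U : Matrix A'' A' ℂ) (hU : IsUnitaryBetween U)
      (h : CLODCC₃ A C B A' C' B' Φ) :
      CLODCC₃ A C B A'' C' B'
        (fun M => conjBy (U ⊗ₖ ((1 : Matrix C' C' ℂ) ⊗ₖ (1 : Matrix B' B' ℂ))) (Φ M))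
  | unitaryC {A' C' B' C'' : QSystem} {Φ} (U : Matrix C'' C' ℂ) (hU : IsUnitaryBetween U)
      (h : CLODCC₃ A C B A' C' B' Φ) :
      CLODCC₃ A C B A' C'' B'
        (fun M => conjBy ((1 : Matrix A' A' ℂ) ⊗ₖ (U ⊗ₖ (1 : Matrix B' B' ℂ))) (Φ M))
  | unitaryB {A' C' B' B'' : QSystem} {Φ} (U : Matrix B'' B' ℂ) (hU : IsUnitaryBetween U)
      (h : CLODCC₃ A C B A' C' B' Φ) :
      CLODCC₃ A C B A' C' B''
        (fun M => conjBy ((1 : Matrix A' A' ℂ) ⊗ₖ ((1 : Matrix C' C' ℂ) ⊗ₖ U)) (Φ M))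
  | sendAB {A' C' B' S : QSystem} {Φ} (h : CLODCC₃ A C B (A'.tensor S) C' B' Φ) :
      CLODCC₃ A C B A' C' (B'.tensor S) (fun M =>
        dephasedTransfer (fun z : A' × C' × (B' × S) => ((z.1, z.2.2.2), z.2.1, z.2.2.1))
          (fun z => z.2.2.2) (Φ M))
  | sendAC {A' C' B' S : QSystem} {Φ} (h : CLODCC₃ A C B (A'.tensor S) C' B' Φ) :
      CLODCC₃ A C B A' (C'.tensor S) B' (fun M =>
        dephasedTransfer (fun z : A' × (C' × S) × B' => ((z.1, z.2.1.2), z.2.1.1, z.2.2))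
          (fun z => z.2.1.2) (Φ M))
  | sendBA {A' C' B' S : QSystem} {Φ} (h : CLODCC₃ A C B A' C' (B'.tensor S) Φ) :
      CLODCC₃ A C B (A'.tensor S) C' B' (fun M =>
        dephasedTransfer (fun z : (A' × S) × C' × B' => (z.1.1, z.2.1, (z.2.2, z.1.2)))
          (fun z => z.1.2) (Φ M))
  | sendBC {A' C' B' S : QSystem} {Φ} (h : CLODCC₃ A C B A' C' (B'.tensor S) Φ) :
      CLODCC₃ A C B A' (C'.tensor S) B' (fun M =>
        dephasedTransfer (fun z : A' × (C' × S) × B' => (z.1, z.2.1.1, (z.2.2, z.2.1.2)))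
          (fun z => z.2.1.2) (Φ M))
  | sendCA {A' C' B' S : QSystem} {Φ} (h : CLODCC₃ A C B A' (C'.tensor S) B' Φ) :
      CLODCC₃ A C B (A'.tensor S) C' B' (fun M =>
        dephasedTransfer (fun z : (A' × S) × C' × B' => (z.1.1, (z.2.1, z.1.2), z.2.2))
          (fun z => z.1.2) (Φ M))
  | sendCB {A' C' B' S : QSystem} {Φ} (h : CLODCC₃ A C B A' (C'.tensor S) B' Φ) :
      CLODCC₃ A C B A' C' (B'.tensor S) (fun M =>
        dephasedTransfer (fun z : A' × C' × (B' × S) => (z.1, (z.2.1, z.2.2.2), z.2.2.1))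
          (fun z => z.2.2.2) (Φ M))
  | limit {A' C' B' : QSystem} {Φ}
      (Φs : ℕ → Matrix (A × C × B) (A × C × B) ℂ → Matrix (A' × C' × B') (A' × C' × B') ℂ)
      (h : ∀ k, CLODCC₃ A C B A' C' B' (Φs k))
      (hlim : ∀ M, Tendsto (fun k => Φs k M) atTop (𝓝 (Φ M))) :
      CLODCC₃ A C B A' C' B' Φ

/-! ### Input states -/

/-- `ρ_{AC₁} ⊗ ρ̃_{C₂B}`, as an operator on `A ⊗ (C₁ ⊗ C₂) ⊗ B`. -/
def jointState {A C₁ C₂ B : QSystem} (ρ : Matrix (A × C₁) (A × C₁) ℂ)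
    (ρt : Matrix (C₂ × B) (C₂ × B) ℂ) :
    Matrix (A × (C₁.tensor C₂) × B) (A × (C₁.tensor C₂) × B) ℂ :=
  Matrix.of fun x y =>
    ρ (x.1, x.2.1.1) (y.1, y.2.1.1) * ρt (x.2.1.2, x.2.2) (y.2.1.2, y.2.2)

/-- `ω^{⊗n}`, each party holding its `n` subsystems. -/
def copies {A C B : QSystem} (ω : Matrix (A × C × B) (A × C × B) ℂ) (n : ℕ) :
    Matrix (A.power n × C.power n × B.power n) (A.power n × C.power n × B.power n) ℂ :=
  Matrix.of fun x y => ∏ k, ω (x.1 k, x.2.1 k, x.2.2 k) (y.1 k, y.2.1 k, y.2.2 k)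

/-! ### The rate of repeated private randomness -/

/-- Partial trace over `C`. -/
def traceC {A C B : QSystem} (M : Matrix (A × C × B) (A × C × B) ℂ) :
    Matrix (A × B) (A × B) ℂ :=
  Matrix.of fun x y => ∑ c, M (x.1, c, x.2) (y.1, c, y.2)

/-- The local idit with `d`-dimensional key system at Alice,
`∑_{i,j} (1/d) |i⟩⟨j| ⊗ U_i σ_{A'B'} U_j†`, i.e. `U (|+⟩⟨+| ⊗ σ) U†` with the controlled
unitary `U = ∑_i |i⟩⟨i| ⊗ U_i`. Alice holds the key system and `A'`, Bob holds `B'`.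
It contains `log₂ d` bits of private randomness. -/
def localIdit (d : ℕ) {A' B' : QSystem} (σ : Matrix (A' × B') (A' × B') ℂ)
    (U : Fin d → Matrix.unitaryGroup (A' × B') ℂ) :
    Matrix (((QSystem.qudit d).tensor A') × B') (((QSystem.qudit d).tensor A') × B') ℂ :=
  Matrix.of fun x y =>
    ((d : ℂ)⁻¹) * ((U x.1.1 : Matrix (A' × B') (A' × B') ℂ) * σ *
      (U y.1.1 : Matrix (A' × B') (A' × B') ℂ)ᴴ) (x.1.2, x.2) (y.1.2, y.2)

/-- The rates `m / n` such that some CLODCC operation of the three parties, followed by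
discarding `C`, brings `ω^{⊗n}` `ε`-close in trace norm to a local idit with `m` private
random bits at Alice. -/
def achievableRates {A C B : QSystem} (ω : Matrix (A × C × B) (A × C × B) ℂ)
    (ε : ℝ) (n : ℕ) : Set EReal :=
  {r | ∃ (d : ℕ) (A' C' B' : QSystem)
      (Φ : Matrix (A.power n × C.power n × B.power n) (A.power n × C.power n × B.power n) ℂ →
        Matrix (((QSystem.qudit d).tensor A') × C' × B')
          (((QSystem.qudit d).tensor A') × C' × B') ℂ)
      (σ : Matrix (A' × B') (A' × B') ℂ) (U : Fin d → Matrix.unitaryGroup (A' × B') ℂ),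
      1 ≤ d ∧ CLODCC₃ (A.power n) (C.power n) (B.power n) ((QSystem.qudit d).tensor A') C' B' Φ ∧
      IsDensity σ ∧ traceNorm (traceC (Φ (copies ω n)) - localIdit d σ U) ≤ ε ∧
      r = ((Real.logb 2 d / n : ℝ) : EReal)}

/-- The private randomness repeater rate `R_A^{A ↔ C ↔ B}(ω)`. -/
def repeaterRate {A C B : QSystem} (ω : Matrix (A × C × B) (A × C × B) ℂ) : EReal :=
  ⨅ (ε : ℝ) (_ : 0 < ε), limsup (fun n : ℕ => sSup (achievableRates ω ε n)) atTop

/-! ### The measured relative entropy -/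

/-- The Kullback-Leibler relative entropy, in bits. -/
def relEntropyBits {X : Type} [Fintype X] (p q : X → ℝ) : EReal :=
  open Classical in
  if ∀ i, q i = 0 → p i = 0 then ((∑ i, p i * Real.logb 2 (p i / q i) : ℝ) : EReal) else ⊤

/-- The outcome distribution of a measurement in the computational basis. -/
def readout {X : Type} (M : Matrix X X ℂ) : X → ℝ := fun i => (M i i).re

/-- The global operator seen in the bipartition `C : AB`. -/
def groupCAB {A C B : QSystem} (ω : Matrix (A × C × B) (A × C × B) ℂ) :
    Matrix (C × (A.tensor B)) (C × (A.tensor B)) ℂ :=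
  Matrix.of fun x y => ω (x.2.1, x.1, x.2.2) (y.2.1, y.1, y.2.2)

/-- The measured relative entropy distance `D_{C ↔ AB}(ω)` from the maximally mixed state.
A measurement in `CLODCC(C : AB)` consists of an operation from this class and a final readout
of all systems in the computational basis. -/
def measuredRelEntropy {A C B : QSystem} (ω : Matrix (A × C × B) (A × C × B) ℂ) : EReal :=
  sSup {v | ∃ (X' Y' : QSystem)
      (Φ : Matrix (C × (A.tensor B)) (C × (A.tensor B)) ℂ → Matrix (X' × Y') (X' × Y') ℂ),
      CLODCC₂ C (A.tensor B) X' Y' Φ ∧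
      v = relEntropyBits (readout (Φ (groupCAB ω)))
        (readout (Φ (maximallyMixed (C × (A.tensor B)))))}

/-- The sequence `(1/n) D_{C ↔ AB}(ω^{⊗n})`. -/
def scaledMeasuredRelEntropy {A C B : QSystem} (ω : Matrix (A × C × B) (A × C × B) ℂ)
    (n : ℕ) : EReal :=
  ((1 / (n : ℝ) : ℝ) : EReal) * measuredRelEntropy (copies ω n)

/-- The regularised measured relative entropy `D^∞_{C ↔ AB}(ω)`. It is written with a lower
limit so that it is always meaningful; that the limit exists is claimed separately. -/
def regularisedMeasuredRelEntropy {A C B : QSystem}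
    (ω : Matrix (A × C × B) (A × C × B) ℂ) : EReal :=
  liminf (scaledMeasuredRelEntropy ω) atTop

end

noncomputable section

/-! ### Elementary maps -/

/-! Upper bound. A protocol producing a local idit yields a measurement in the cut `C : AB` that
tells the input from the maximally mixed state. Merging Alice and Bob turns every three-party
operation into a two-party one (`CLODCC₃.toCLODCC₂`). The merged lab can then undo the controlled
unitary of the idit, which leaves the key close to the uniform superposition, and rotate that
superposition to the first basis vector. The first key value is then read out with probability at
least `1 - ε`. Closed operations are unital, so on the maximally mixed state the same event has
probability exactly `1 / d`. An entropy inequality for a single event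
(`sum_mul_logb_sub_one_le_entropyDeficit`) gives `(1 - ε) log d - 1` as a lower bound on the
measured relative entropy (`logb_le_of_traceNorm_le`). Applying this to `n` copies, dividing by `n`,
and letting `n → ∞` and then `ε → 0` proves the bound.

Existence of the limit. By unitality the reference outcome distribution is always uniform, so the
measured relative entropy is a bounded supremum of real entropy deficits. Running two measurements
in parallel is again allowed and adds the deficits (`add_mem_measuredDeficits`). The sequence is
therefore superadditive with at most linear growth, and Fekete's lemma applies. -/

lemma conjBy_kronecker_one_apply {X X' Y : Type} [Fintype X] [Fintype Y] [DecidableEq Y]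
    (U : Matrix X' X ℂ) (M : Matrix (X × Y) (X × Y) ℂ) (p q : X' × Y) :
    conjBy (U ⊗ₖ (1 : Matrix Y Y ℂ)) M p q =
      ∑ b, ∑ a, U p.1 a * M (a, p.2) (b, q.2) * star (U q.1 b) := by
  simp [conjBy, Matrix.mul_apply, Fintype.sum_prod_type, Matrix.one_apply, Finset.sum_mul,
    apply_ite]

lemma conjBy_one_kronecker_apply {X Y Y' : Type} [Fintype X] [DecidableEq X] [Fintype Y]
    (U : Matrix Y' Y ℂ) (M : Matrix (X × Y) (X × Y) ℂ) (p q : X × Y') :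
    conjBy ((1 : Matrix X X ℂ) ⊗ₖ U) M p q =
      ∑ b, ∑ a, U p.2 a * M (p.1, a) (q.1, b) * star (U q.2 b) := by
  simp [conjBy, Matrix.mul_apply, Fintype.sum_prod_type, Matrix.one_apply, Finset.sum_mul,
    apply_ite]

/-- The unitary that relabels basis vectors. -/
def relabelMatrix {X Y : Type} [DecidableEq X] (e : Y → X) : Matrix Y X ℂ :=
  Matrix.of fun y x => if e y = x then 1 else 0

lemma isUnitaryBetween_relabelMatrix {X Y : QSystem} (e : Y ≃ X) :
    IsUnitaryBetween (A := X) (A' := Y) (relabelMatrix e) := by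
  constructor
  · ext i j
    simp only [relabelMatrix, Matrix.mul_apply, Matrix.conjTranspose_apply, Matrix.of_apply,
      Matrix.one_apply]
    rw [← Equiv.sum_comp e.symm]
    simp only [Equiv.apply_symm_apply, apply_ite, star_one, star_zero, mul_one, mul_zero]
    simp only [Finset.sum_ite_eq', Finset.mem_univ, if_true]
    grind
  · ext i j
    simp [relabelMatrix, Matrix.mul_apply, Matrix.one_apply, apply_ite, eq_comm]

namespace CLODCC₂

variable {X Y X' Y' X'' Y'' : QSystem} {Φ : Matrix (X × Y) (X × Y) ℂ → Matrix (X' × Y') (X' × Y') ℂ}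

/-- A permutation of basis labels is a local unitary, so regrouping the factors inside one lab is
free. -/
lemma relabelX (h : CLODCC₂ X Y X' Y' Φ) (e : X'' ≃ X') :
    CLODCC₂ X Y X'' Y' fun M => (Φ M).submatrix (fun z => (e z.1, z.2)) fun z => (e z.1, z.2) := by
  convert h.unitaryX _ (isUnitaryBetween_relabelMatrix e) using 2 with M
  ext p q
  simp [conjBy_kronecker_one_apply, relabelMatrix, apply_ite]

lemma relabelY (h : CLODCC₂ X Y X' Y' Φ) (e : Y'' ≃ Y') :
    CLODCC₂ X Y X' Y'' fun M => (Φ M).submatrix (fun z => (z.1, e z.2)) fun z => (z.1, e z.2) := by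
  convert h.unitaryY _ (isUnitaryBetween_relabelMatrix e) using 2 with M
  ext p q
  simp [conjBy_one_kronecker_apply, relabelMatrix, apply_ite]

/-- Local dephasing, realised by sending the register to the other party and back. -/
lemma dephaseY {S : QSystem} {Φ : Matrix (X × Y) (X × Y) ℂ → Matrix (X' × Y') (X' × Y') ℂ}
    (h : CLODCC₂ X Y X' Y' Φ) (e : Y''.tensor S ≃ Y') :
    CLODCC₂ X Y X' (Y''.tensor S) fun M =>
      dephasedTransfer (fun z : X' × (Y'' × S) => (z.1, e z.2)) (fun z => z.2.2) (Φ M) := by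
  convert ((h.relabelY e).sendYX).sendXY using 2 with M
  ext p q
  simp only [dephasedTransfer, Matrix.of_apply, Matrix.submatrix_apply]
  split_ifs <;> rfl

lemma comp (h : CLODCC₂ X Y X' Y' Φ)
    {Ψ : Matrix (X' × Y') (X' × Y') ℂ → Matrix (X'' × Y'') (X'' × Y'') ℂ}
    (h' : CLODCC₂ X' Y' X'' Y'' Ψ) : CLODCC₂ X Y X'' Y'' fun M => Ψ (Φ M) := by
  induction h' with
  | id => exact h
  | unitaryX U hU _ ih => exact ih.unitaryX U hU
  | unitaryY U hU _ ih => exact ih.unitaryY U hU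
  | sendXY _ ih => exact ih.sendXY
  | sendYX _ ih => exact ih.sendYX
  | limit Φs _ hlim ih => exact CLODCC₂.limit _ ih fun M => hlim (Φ M)

/-! ### Invariants of the class -/

/-- Homogeneity is the only part of linearity needed: it normalises the maximally mixed state and
evaluates `ampliation` on product operators. -/
lemma map_smul (h : CLODCC₂ X Y X' Y' Φ) (c : ℂ) (M) : Φ (c • M) = c • Φ M := by
  induction h with
  | id => rfl
  | unitaryX U hU _ ih => simp [ih, conjBy]
  | unitaryY U hU _ ih => simp [ih, conjBy]
  | sendXY _ ih => ext; simp [ih, dephasedTransfer]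
  | sendYX _ ih => ext; simp [ih, dephasedTransfer]
  | limit Φs _ hlim ih =>
    refine tendsto_nhds_unique (hlim _) ?_
    simp_rw [ih]
    exact (hlim M).const_smul c

lemma conjBy_one_of_coisometry {X Y : Type} [Fintype X] [DecidableEq X] [DecidableEq Y]
    {V : Matrix Y X ℂ} (hV : V * Vᴴ = 1) : conjBy V 1 = 1 := by
  simp [conjBy, hV]

lemma trace_conjBy_of_isometry {X Y : Type} [Fintype X] [Fintype Y] [DecidableEq X]
    {V : Matrix Y X ℂ} (hV : Vᴴ * V = 1) (M : Matrix X X ℂ) :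
    (conjBy V M).trace = M.trace := by
  rw [conjBy, Matrix.trace_mul_cycle, hV, one_mul]

lemma trace_map (h : CLODCC₂ X Y X' Y' Φ) (M) : (Φ M).trace = M.trace := by
  induction h with
  | id => rfl
  | unitaryX U hU _ ih =>
    rw [trace_conjBy_of_isometry, ih]
    rw [Matrix.conjTranspose_kronecker, ← Matrix.mul_kronecker_mul, hU.1]; simp
  | unitaryY U hU _ ih =>
    rw [trace_conjBy_of_isometry, ih]
    rw [Matrix.conjTranspose_kronecker, ← Matrix.mul_kronecker_mul, hU.1]; simp
  | @sendXY X' Y' S Φ _ ih =>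
    rw [← ih]
    simp only [Matrix.trace, dephasedTransfer, Matrix.diag_apply, Matrix.of_apply, if_true,
      Fintype.sum_prod_type]
    exact Finset.sum_congr rfl fun _ _ => Finset.sum_comm
  | @sendYX X' Y' S Φ _ ih =>
    rw [← ih]
    simp only [Matrix.trace, dephasedTransfer, Matrix.diag_apply, Matrix.of_apply, if_true,
      Fintype.sum_prod_type]
    exact Finset.sum_congr rfl fun _ _ => Finset.sum_comm
  | limit Φs _ hlim ih =>
    refine tendsto_nhds_unique ((Continuous.matrix_trace continuous_id).tendsto _ |>.comp (hlim M)) ?_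
    simp [Function.comp_def, ih]

/-- Unitaries and dephasing fix the identity, and without ancillas or discarding nothing else
occurs. This is what keeps the reference state maximally mixed. -/
lemma map_one (h : CLODCC₂ X Y X' Y' Φ) : Φ 1 = 1 := by
  induction h with
  | id => rfl
  | unitaryX U hU _ ih =>
    beta_reduce
    rw [ih, conjBy_one_of_coisometry]
    rw [Matrix.conjTranspose_kronecker, ← Matrix.mul_kronecker_mul, hU.2]; simp
  | unitaryY U hU _ ih =>
    beta_reduce
    rw [ih, conjBy_one_of_coisometry]
    rw [Matrix.conjTranspose_kronecker, ← Matrix.mul_kronecker_mul, hU.2]; simp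
  | sendXY _ ih =>
    ext ⟨a, b, c⟩ ⟨a', b', c'⟩
    simp only [ih, dephasedTransfer, Matrix.of_apply, Matrix.one_apply, Prod.mk.injEq]
    split_ifs <;> simp_all
  | sendYX _ ih =>
    ext ⟨⟨a, b⟩, c⟩ ⟨⟨a', b'⟩, c'⟩
    simp only [ih, dephasedTransfer, Matrix.of_apply, Matrix.one_apply, Prod.mk.injEq]
    split_ifs <;> simp_all
  | limit Φs _ hlim ih =>
    refine tendsto_nhds_unique (hlim 1) ?_
    simp [ih]

end CLODCC₂

lemma Matrix.PosSemidef.conjBy {X Y : Type} [Fintype X] [Fintype Y] {M : Matrix X X ℂ}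
    (hM : M.PosSemidef) (V : Matrix Y X ℂ) : (conjBy V M).PosSemidef :=
  hM.mul_mul_conjTranspose_same V

lemma Matrix.PosSemidef.dephasedTransfer {X Y S : Type} [Fintype X] [Fintype Y] [Fintype S]
    [DecidableEq Y] [DecidableEq S] {M : Matrix X X ℂ} (hM : M.PosSemidef) (e : Y → X) (s : Y → S) :
    (dephasedTransfer e s M).PosSemidef := by
  -- Dephasing is a pinching: the sum over register values `t` of compressions to the subspace where
  -- `s = t`.
  have : _root_.dephasedTransfer e s M = ∑ t, _root_.conjBy
      (Matrix.diagonal fun y => if s y = t then (1 : ℂ) else 0) (M.submatrix e e) := by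
    ext i j
    simp [_root_.dephasedTransfer, Matrix.sum_apply, _root_.conjBy, Matrix.diagonal_conjTranspose,
      apply_ite, eq_comm]
    grind
  rw [this]
  exact Matrix.posSemidef_sum _ fun t _ => (hM.submatrix e).conjBy _

lemma Matrix.PosSemidef.of_tendsto {X : Type} [Fintype X] {Ms : ℕ → Matrix X X ℂ}
    {M : Matrix X X ℂ} (h : ∀ k, (Ms k).PosSemidef) (hlim : Tendsto Ms atTop (𝓝 M)) :
    M.PosSemidef := by
  refine Matrix.PosSemidef.of_dotProduct_mulVec_nonneg ?_ fun x => ?_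
  · refine tendsto_nhds_unique ((Continuous.matrix_conjTranspose continuous_id).tendsto _ |>.comp hlim) ?_
    simpa [Function.comp_def, (h _).1.eq] using hlim
  · refine ge_of_tendsto' (x := atTop)
      (f := fun k => star x ⬝ᵥ (Ms k).mulVec x) ?_ fun k => (h k).dotProduct_mulVec_nonneg x
    have : Continuous fun N : Matrix X X ℂ => star x ⬝ᵥ N.mulVec x := by fun_prop
    exact (this.tendsto M).comp hlim

namespace CLODCC₂
variable {X Y X' Y' X'' Y'' : QSystem} {Φ : Matrix (X × Y) (X × Y) ℂ → Matrix (X' × Y') (X' × Y') ℂ}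

lemma posSemidef (h : CLODCC₂ X Y X' Y' Φ) {M} (hM : M.PosSemidef) : (Φ M).PosSemidef := by
  induction h with
  | id => exact hM
  | unitaryX U hU _ ih => exact ih.conjBy _
  | unitaryY U hU _ ih => exact ih.conjBy _
  | sendXY _ ih => exact ih.dephasedTransfer _ _
  | sendYX _ ih => exact ih.dephasedTransfer _ _
  | limit Φs _ hlim ih => exact .of_tendsto ih (hlim M)

lemma isDensity (h : CLODCC₂ X Y X' Y' Φ) {M} (hM : IsDensity M) : IsDensity (Φ M) :=
  ⟨h.posSemidef hM.1, (h.trace_map M).trans hM.2⟩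

/-- The trace of the identity is the dimension, and it is preserved by a unital trace-preserving
map. -/
lemma card_eq (h : CLODCC₂ X Y X' Y' Φ) : Fintype.card (X' × Y') = Fintype.card (X × Y) := by
  have := h.trace_map 1
  rw [h.map_one, Matrix.trace_one, Matrix.trace_one] at this
  exact_mod_cast this

lemma map_maximallyMixed (h : CLODCC₂ X Y X' Y' Φ) :
    Φ (maximallyMixed (X × Y)) = maximallyMixed (X' × Y') := by
  rw [maximallyMixed, h.map_smul, h.map_one, maximallyMixed, h.card_eq]

/-! ### Tensor products of operations -/

/-- Exchange of the last two factors of a triple product. -/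
def _root_.prodRightComm (α β γ : Type) : (α × β) × γ ≃ (α × γ) × β where
  toFun z := ((z.1.1, z.2), z.1.2)
  invFun z := ((z.1.1, z.2), z.1.2)

/-- The map `Φ ⊗ id`, with the additional systems `Z` and `W` held by the two parties. -/
def ampliation (Z W : QSystem)
    (Φ : Matrix (X × Y) (X × Y) ℂ → Matrix (X' × Y') (X' × Y') ℂ)
    (M : Matrix ((X × Z) × (Y × W)) ((X × Z) × (Y × W)) ℂ) :
    Matrix ((X' × Z) × (Y' × W)) ((X' × Z) × (Y' × W)) ℂ :=
  Matrix.of fun p q =>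
    Φ (M.submatrix (fun a => ((a.1, p.1.2), (a.2, p.2.2))) fun b => ((b.1, q.1.2), (b.2, q.2.2)))
      (p.1.1, p.2.1) (q.1.1, q.2.1)

lemma _root_.IsUnitaryBetween.kronecker_one {U : Matrix X' X ℂ} (hU : IsUnitaryBetween U) (Z : QSystem) :
    IsUnitaryBetween (A := X.tensor Z) (A' := X'.tensor Z) (U ⊗ₖ (1 : Matrix Z Z ℂ)) := by
  constructor <;>
  rw [Matrix.conjTranspose_kronecker, ← Matrix.mul_kronecker_mul] <;> simp [hU.1, hU.2]

/-- Each generator acts on its own factors beside a spectator. For transmissions, the sent factor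
must first be moved past the spectator and the received one moved back. -/
lemma ampliate (h : CLODCC₂ X Y X' Y' Φ) (Z W : QSystem) :
    CLODCC₂ (X.tensor Z) (Y.tensor W) (X'.tensor Z) (Y'.tensor W) (ampliation Z W Φ) := by
  induction h with
  | id => exact CLODCC₂.id
  | unitaryX U hU _ ih =>
    convert ih.unitaryX _ (hU.kronecker_one Z) using 2 with M
    ext p q
    simp [ampliation, conjBy_kronecker_one_apply, Fintype.sum_prod_type, Matrix.one_apply,
      apply_ite]
  | unitaryY U hU _ ih =>
    convert ih.unitaryY _ (hU.kronecker_one W) using 2 with M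
    ext p q
    simp [ampliation, conjBy_one_kronecker_apply, Fintype.sum_prod_type, Matrix.one_apply,
      apply_ite]
  | @sendXY X' Y' S Φ _ ih =>
    convert (ih.relabelX (X'' := (X'.tensor Z).tensor S) (prodRightComm X' Z S)).sendXY.relabelY
      (Y'' := (Y'.tensor S).tensor W) (prodRightComm Y' S W) using 2 with M
    ext p q
    simp only [ampliation, dephasedTransfer, prodRightComm, Matrix.of_apply, Matrix.submatrix_apply,
      Equiv.coe_fn_mk]
  | @sendYX X' Y' S Φ _ ih =>
    convert (ih.relabelY (Y'' := (Y'.tensor W).tensor S) (prodRightComm Y' W S)).sendYX.relabelX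
      (X'' := (X'.tensor S).tensor Z) (prodRightComm X' S Z) using 2 with M
    ext p q
    simp only [ampliation, dephasedTransfer, prodRightComm, Matrix.of_apply, Matrix.submatrix_apply,
      Equiv.coe_fn_mk]
  | limit Φs _ hlim ih =>
    refine CLODCC₂.limit _ ih fun M => ?_
    refine tendsto_pi_nhds.2 fun p => tendsto_pi_nhds.2 fun q => ?_
    exact tendsto_pi_nhds.1 (tendsto_pi_nhds.1 (hlim _) _) _

end CLODCC₂

/-! ### Three-party operations in the bipartition `C : AB` -/

/-- Inverse of `groupCAB`. -/
def ungroupCAB {A C B : QSystem} (N : Matrix (C × (A.tensor B)) (C × (A.tensor B)) ℂ) :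
    Matrix (A × C × B) (A × C × B) ℂ :=
  Matrix.of fun x y => N (x.2.1, x.1, x.2.2) (y.2.1, y.1, y.2.2)

lemma IsUnitaryBetween.one_kronecker {X X' : QSystem} {U : Matrix X' X ℂ}
    (hU : IsUnitaryBetween U) (Z : QSystem) :
    IsUnitaryBetween (A := Z.tensor X) (A' := Z.tensor X') ((1 : Matrix Z Z ℂ) ⊗ₖ U) := by
  constructor <;>
  rw [Matrix.conjTranspose_kronecker, ← Matrix.mul_kronecker_mul] <;> simp [hU.1, hU.2]

/-- Messages between Alice and Bob become a local dephasing in the merged lab, realised by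
`CLODCC₂.dephaseY`; messages to or from `C` stay messages, up to regrouping. -/
lemma CLODCC₃.toCLODCC₂ {A C B A' C' B' : QSystem}
    {Φ : Matrix (A × C × B) (A × C × B) ℂ → Matrix (A' × C' × B') (A' × C' × B') ℂ}
    (h : CLODCC₃ A C B A' C' B' Φ) :
    CLODCC₂ C (A.tensor B) C' (A'.tensor B') fun N => groupCAB (Φ (ungroupCAB N)) := by
  induction h with
  | id => exact CLODCC₂.id
  | unitaryA U hU _ ih =>
    convert ih.unitaryY _ (hU.kronecker_one _) using 2 with M
    ext p q
    simp [groupCAB, conjBy_kronecker_one_apply,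
      conjBy_one_kronecker_apply, Fintype.sum_prod_type, Matrix.one_apply, apply_ite]
  | unitaryC U hU _ ih =>
    convert ih.unitaryX U hU using 2 with M
    ext p q
    simp [groupCAB, conjBy_kronecker_one_apply,
      conjBy_one_kronecker_apply, Fintype.sum_prod_type, Matrix.one_apply, apply_ite]
  | unitaryB U hU _ ih =>
    convert ih.unitaryY _ (hU.one_kronecker _) using 2 with M
    ext p q
    simp [groupCAB,
      conjBy_one_kronecker_apply, Fintype.sum_prod_type, Matrix.one_apply, apply_ite]
  | @sendAB A' C' B' S Φ _ ih =>
    exact (ih.dephaseY (S := S) (Y'' := A'.tensor B') (prodRightComm A' B' S)).relabelY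
      (Y'' := A'.tensor (B'.tensor S)) (Equiv.prodAssoc A' B' S).symm
  | @sendBA A' C' B' S Φ _ ih =>
    exact (ih.dephaseY (S := S) (Y'' := A'.tensor B') (Equiv.prodAssoc A' B' S)).relabelY
      (Y'' := (A'.tensor S).tensor B') (prodRightComm A' S B')
  | @sendAC A' C' B' S Φ _ ih =>
    exact (ih.relabelY (Y'' := (A'.tensor B').tensor S) (prodRightComm A' B' S)).sendYX
  | @sendBC A' C' B' S Φ _ ih =>
    exact (ih.relabelY (Y'' := (A'.tensor B').tensor S) (Equiv.prodAssoc A' B' S)).sendYX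
  | @sendCA A' C' B' S Φ _ ih =>
    exact ih.sendXY.relabelY (Y'' := (A'.tensor S).tensor B') (prodRightComm A' S B')
  | @sendCB A' C' B' S Φ _ ih =>
    exact ih.sendXY.relabelY (Y'' := A'.tensor (B'.tensor S)) (Equiv.prodAssoc A' B' S).symm
  | limit Φs _ hlim ih =>
    refine CLODCC₂.limit _ ih fun M => ?_
    refine tendsto_pi_nhds.2 fun p => tendsto_pi_nhds.2 fun q => ?_
    exact tendsto_pi_nhds.1 (tendsto_pi_nhds.1 (hlim _) _) _

/-! ### Relative entropy with respect to the uniform distribution -/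

/-- The relative entropy of `p` with respect to the uniform distribution, in bits. -/
def entropyDeficit {X : Type} [Fintype X] (p : X → ℝ) : ℝ :=
  ∑ i, p i * Real.logb 2 (p i * Fintype.card X)

lemma relEntropyBits_readout_maximallyMixed {X : Type} [Fintype X] [DecidableEq X] (p : X → ℝ) :
    relEntropyBits p (readout (maximallyMixed X)) = (entropyDeficit p : EReal) := by
  have hq : ∀ i, readout (maximallyMixed X) i = (Fintype.card X : ℝ)⁻¹ := fun i => by
    have : ((Fintype.card X : ℂ)⁻¹).re = (Fintype.card X : ℝ)⁻¹ := by
      rw [← Complex.ofReal_natCast, ← Complex.ofReal_inv, Complex.ofReal_re]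
    simp [readout, maximallyMixed, this]
  rw [relEntropyBits, if_pos]
  · simp [entropyDeficit, hq]
  · intro i hi
    have : Nonempty X := ⟨i⟩
    simp [hq] at hi

lemma readout_mem_stdSimplex {X : Type} [Fintype X] {M : Matrix X X ℂ} (hM : IsDensity M) :
    readout M ∈ stdSimplex ℝ X := by
  refine ⟨fun i => ?_, ?_⟩
  · exact (Complex.le_def.1 (hM.1.diag_nonneg (i := i))).1
  · have := congrArg Complex.re hM.2
    simpa [Matrix.trace, readout] using this

lemma entropyDeficit_le {X : Type} [Fintype X] {p : X → ℝ} (hp : p ∈ stdSimplex ℝ X) :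
    entropyDeficit p ≤ Real.logb 2 (Fintype.card X) := by
  rw [← one_mul (Real.logb 2 _), ← hp.2, Finset.sum_mul]
  refine Finset.sum_le_sum fun i _ => ?_
  have hi : p i ≤ 1 := hp.2 ▸ Finset.single_le_sum (fun j _ => hp.1 j) (Finset.mem_univ i)
  rcases (hp.1 i).eq_or_lt with h | h
  · simp [← h]
  have : Nonempty X := ⟨i⟩
  have hc : (0 : ℝ) < Fintype.card X := by exact_mod_cast Fintype.card_pos
  refine mul_le_mul_of_nonneg_left ?_ h.le
  exact Real.logb_le_logb_of_le one_lt_two (by positivity) (by nlinarith)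

lemma entropyDeficit_prod {X Y Z : Type} [Fintype X] [Fintype Y] [Fintype Z] (e : X × Y ≃ Z)
    {p : X → ℝ} {q : Y → ℝ} {r : Z → ℝ} (hp : p ∈ stdSimplex ℝ X) (hq : q ∈ stdSimplex ℝ Y)
    (hr : ∀ x y, r (e (x, y)) = p x * q y) :
    entropyDeficit r = entropyDeficit p + entropyDeficit q := by
  have key : ∀ x y, r (e (x, y)) * Real.logb 2 (r (e (x, y)) * Fintype.card Z) =
      p x * Real.logb 2 (p x * Fintype.card X) * q y +
        p x * (q y * Real.logb 2 (q y * Fintype.card Y)) := fun x y => by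
    rw [hr, ← Fintype.card_congr e, Fintype.card_prod]
    rcases eq_or_ne (p x) 0 with h | h
    · simp [h]
    rcases eq_or_ne (q y) 0 with h' | h'
    · simp [h']
    have : Nonempty X := ⟨x⟩
    have : Nonempty Y := ⟨y⟩
    have hX : (Fintype.card X : ℝ) ≠ 0 := by exact_mod_cast Fintype.card_ne_zero
    have hY : (Fintype.card Y : ℝ) ≠ 0 := by exact_mod_cast Fintype.card_ne_zero
    rw [Nat.cast_mul, mul_mul_mul_comm, Real.logb_mul (by positivity) (by positivity)]
    ring
  rw [entropyDeficit, ← Equiv.sum_comp e, Fintype.sum_prod_type]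
  simp_rw [key, Finset.sum_add_distrib, ← Finset.mul_sum, ← Finset.sum_mul, hq.2, hp.2]
  simp [entropyDeficit]

/-- An event which has probability `1 / d` under the uniform distribution. -/
lemma sum_mul_logb_sub_one_le_entropyDeficit {X : Type} [Fintype X] [DecidableEq X] {p : X → ℝ}
    (hp : p ∈ stdSimplex ℝ X) (s : Finset X) {d : ℕ} (hd : 1 ≤ d)
    (hs : Fintype.card X = d * s.card) :
    (∑ i ∈ s, p i) * Real.logb 2 d - 1 ≤ entropyDeficit p := by
  have hd' : (0 : ℝ) < d := by exact_mod_cast hd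
  have hN : (0 : ℝ) < Fintype.card X := by
    have : Nonempty X := by
      by_contra h
      rw [not_nonempty_iff] at h
      simpa using hp.2
    exact_mod_cast Fintype.card_pos
  have hs' : (Fintype.card X : ℝ) = d * s.card := by exact_mod_cast hs
  -- Density, relative to uniform, of the even mixture of uniform and uniform-on-`s`, with the extra
  -- `1/2` on `s` dropped. It is subnormalised, and its logarithm is `log d - 1` on `s` and `-1`
  -- elsewhere.
  let g : X → ℝ := fun i => if i ∈ s then d / 2 else 1 / 2
  have hg : ∀ i, 0 < g i := fun i => by dsimp only [g]; split_ifs <;> positivity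
  have hsum : ∑ i, g i / Fintype.card X ≤ 1 := by
    rw [← Finset.sum_div, div_le_one hN]
    have : ∀ i, g i ≤ (if i ∈ s then (d : ℝ) / 2 else 0) + 1 / 2 := fun i => by
      dsimp only [g]; split_ifs <;> linarith
    refine (Finset.sum_le_sum fun i _ => this i).trans ?_
    rw [Finset.sum_add_distrib]
    simp only [Finset.sum_ite_mem, Finset.univ_inter, Finset.sum_const, nsmul_eq_mul,
      Finset.card_univ]
    linarith
  -- Gibbs' inequality pointwise, from `log x ≥ 1 - 1/x` at the ratio of `p i` to `g i / card X`;
  -- the correction terms sum to a nonnegative number.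
  have hpt : ∀ i, p i * Real.logb 2 (g i) + (p i - g i / Fintype.card X) / Real.log 2 ≤
      p i * Real.logb 2 (p i * Fintype.card X) := fun i => by
    have hl : 0 < Real.log 2 := Real.log_pos one_lt_two
    rcases (hp.1 i).eq_or_lt with h | h
    · rw [← h]
      have := hg i
      simp only [zero_mul, zero_sub, zero_add]
      rw [neg_div, neg_nonpos]
      positivity
    · have hx : 0 < p i * Fintype.card X / g i := div_pos (mul_pos h hN) (hg i)
      have h1 := Real.one_sub_inv_le_log_of_pos hx
      rw [Real.log_div (mul_pos h hN).ne' (hg i).ne', inv_div] at h1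
      have h2 := mul_le_mul_of_nonneg_left h1 h.le
      have h3 : p i * (1 - g i / (p i * Fintype.card X)) = p i - g i / Fintype.card X := by
        field_simp
      rw [h3] at h2
      simp only [Real.logb]
      rw [mul_div_assoc', mul_div_assoc', ← add_div]
      gcongr
      linarith
  calc (∑ i ∈ s, p i) * Real.logb 2 d - 1
      = ∑ i, p i * Real.logb 2 (g i) := by
        have h2 : Real.logb 2 (d / 2) = Real.logb 2 d - 1 := by
          rw [Real.logb_div hd'.ne' two_ne_zero, Real.logb_self_eq_one one_lt_two]
        have h3 : Real.logb 2 (1 / 2) = -1 := by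
          rw [one_div, Real.logb_inv, Real.logb_self_eq_one one_lt_two]
        have : ∀ i, p i * Real.logb 2 (g i) = (if i ∈ s then p i * Real.logb 2 d else 0) - p i :=
          fun i => by
            dsimp only [g]; split_ifs
            · rw [h2]; ring
            · rw [h3]; ring
        simp_rw [this, Finset.sum_sub_distrib, hp.2, Finset.sum_ite_mem, Finset.univ_inter,
          Finset.sum_mul]
    _ ≤ ∑ i, (p i * Real.logb 2 (g i) + (p i - g i / Fintype.card X) / Real.log 2) := by
        rw [Finset.sum_add_distrib, ← Finset.sum_div, Finset.sum_sub_distrib, hp.2]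
        have : 0 ≤ (1 - ∑ i, g i / Fintype.card X) / Real.log 2 :=
          div_nonneg (by linarith) (Real.log_pos one_lt_two).le
        linarith
    _ ≤ _ := Finset.sum_le_sum fun i _ => hpt i

/-! ### The measured relative entropy is a real number -/

/-- The values over which `measuredRelEntropy` takes the supremum. -/
def measuredDeficits {A C B : QSystem} (ω : Matrix (A × C × B) (A × C × B) ℂ) : Set ℝ :=
  {v | ∃ (X' Y' : QSystem)
      (Φ : Matrix (C × (A.tensor B)) (C × (A.tensor B)) ℂ → Matrix (X' × Y') (X' × Y') ℂ),
      CLODCC₂ C (A.tensor B) X' Y' Φ ∧ v = entropyDeficit (readout (Φ (groupCAB ω)))}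

lemma IsDensity.submatrix_equiv {X Y : Type} [Fintype X] [Fintype Y] {M : Matrix X X ℂ}
    (hM : IsDensity M) (e : Y ≃ X) : IsDensity (M.submatrix e e) :=
  ⟨hM.1.submatrix e, by rw [← hM.2]; exact Equiv.sum_comp e fun i => M i i⟩

lemma IsDensity.groupCAB {A C B : QSystem} {ω : Matrix (A × C × B) (A × C × B) ℂ}
    (hω : IsDensity ω) : IsDensity (groupCAB ω) :=
  hω.submatrix_equiv (Y := C × A × B)
    ⟨fun x => (x.2.1, x.1, x.2.2), fun x => (x.2.1, x.1, x.2.2), fun _ => rfl, fun _ => rfl⟩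

section

variable {A C B : QSystem} {ω : Matrix (A × C × B) (A × C × B) ℂ}

lemma measuredDeficits_nonempty : (measuredDeficits ω).Nonempty := ⟨_, _, _, _, .id, rfl⟩

lemma le_of_mem_measuredDeficits (hω : IsDensity ω) {v : ℝ} (hv : v ∈ measuredDeficits ω) :
    v ≤ Real.logb 2 (Fintype.card (C × A × B)) := by
  obtain ⟨X', Y', Φ, hΦ, rfl⟩ := hv
  rw [← hΦ.card_eq]
  exact entropyDeficit_le (readout_mem_stdSimplex (hΦ.isDensity hω.groupCAB))

lemma bddAbove_measuredDeficits (hω : IsDensity ω) : BddAbove (measuredDeficits ω) :=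
  ⟨_, fun _ => le_of_mem_measuredDeficits hω⟩

lemma measuredRelEntropy_eq (hω : IsDensity ω) :
    measuredRelEntropy ω = ((sSup (measuredDeficits ω) : ℝ) : EReal) := by
  have hset : measuredRelEntropy ω = sSup ((↑) '' measuredDeficits ω : Set EReal) := by
    refine congrArg sSup (Set.ext fun v => ?_)
    simp only [measuredDeficits, Set.mem_ofPred_eq, Set.mem_image]
    constructor
    · rintro ⟨X', Y', Φ, hΦ, rfl⟩
      exact ⟨_, ⟨X', Y', Φ, hΦ, rfl⟩, by
        rw [hΦ.map_maximallyMixed, relEntropyBits_readout_maximallyMixed]⟩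
    · rintro ⟨_, ⟨X', Y', Φ, hΦ, rfl⟩, rfl⟩
      exact ⟨X', Y', Φ, hΦ, by
        rw [hΦ.map_maximallyMixed, relEntropyBits_readout_maximallyMixed]⟩
  rw [hset]
  exact (Monotone.map_csSup_of_continuousAt continuous_coe_real_ereal.continuousAt
    EReal.coe_strictMono.monotone measuredDeficits_nonempty (bddAbove_measuredDeficits hω)).symm

end

/-! ### Tensor powers -/

/-- The product of two bipartite states. -/
def tensorState {X₁ Y₁ X₂ Y₂ : Type} (M₁ : Matrix (X₁ × Y₁) (X₁ × Y₁) ℂ)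
    (M₂ : Matrix (X₂ × Y₂) (X₂ × Y₂) ℂ) :
    Matrix ((X₁ × X₂) × (Y₁ × Y₂)) ((X₁ × X₂) × (Y₁ × Y₂)) ℂ :=
  Matrix.of fun p q => M₁ (p.1.1, p.2.1) (q.1.1, q.2.1) * M₂ (p.1.2, p.2.2) (q.1.2, q.2.2)

/-- Fixing the spectator indices leaves a scalar multiple of `M`, so homogeneity of `Φ` suffices. -/
lemma CLODCC₂.ampliation_tensorState {X Y X' Y' Z W : QSystem}
    {Φ : Matrix (X × Y) (X × Y) ℂ → Matrix (X' × Y') (X' × Y') ℂ} (h : CLODCC₂ X Y X' Y' Φ)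
    (M : Matrix (X × Y) (X × Y) ℂ) (N : Matrix (Z × W) (Z × W) ℂ) :
    ampliation Z W Φ (tensorState M N) = tensorState (Φ M) N := by
  ext p q
  have : ((tensorState M N).submatrix (fun a : X × Y => ((a.1, p.1.2), (a.2, p.2.2)))
      fun b : X × Y => ((b.1, q.1.2), (b.2, q.2.2))) =
        N (p.1.2, p.2.2) (q.1.2, q.2.2) • M := by
    ext a b
    simp [tensorState, mul_comm]
  rw [ampliation, Matrix.of_apply, this, h.map_smul]
  simp [tensorState, mul_comm]

/-- Run `Φ` beside a spectator, swap the factors, then run `Ψ`. The swap is left in the output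
because the entropy of the readout does not see it. -/
lemma CLODCC₂.exists_tensor {X₁ Y₁ X₂ Y₂ X₁' Y₁' X₂' Y₂' : QSystem}
    {Φ : Matrix (X₁ × Y₁) (X₁ × Y₁) ℂ → Matrix (X₁' × Y₁') (X₁' × Y₁') ℂ}
    {Ψ : Matrix (X₂ × Y₂) (X₂ × Y₂) ℂ → Matrix (X₂' × Y₂') (X₂' × Y₂') ℂ}
    (hΦ : CLODCC₂ X₁ Y₁ X₁' Y₁' Φ) (hΨ : CLODCC₂ X₂ Y₂ X₂' Y₂' Ψ) :
    ∃ Θ, CLODCC₂ (X₁.tensor X₂) (Y₁.tensor Y₂) (X₂'.tensor X₁') (Y₂'.tensor Y₁') Θ ∧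
      ∀ M N, Θ (tensorState M N) = tensorState (Ψ N) (Φ M) := by
  refine ⟨_, (((hΦ.ampliate X₂ Y₂).relabelX (X'' := X₂.tensor X₁')
    (Equiv.prodComm X₂ X₁')).relabelY (Y'' := Y₂.tensor Y₁') (Equiv.prodComm Y₂ Y₁')).comp
      (hΨ.ampliate X₁' Y₁'), fun M N => ?_⟩
  rw [hΦ.ampliation_tensorState, ← hΨ.ampliation_tensorState]
  congr 1
  ext p q
  simp [tensorState, mul_comm]

lemma submatrix_groupCAB_copies {A C B : QSystem} (ω : Matrix (A × C × B) (A × C × B) ℂ)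
    (m n : ℕ) :
    (groupCAB (copies ω (m + n))).submatrix
        (fun z : ((C.power m).tensor (C.power n)) ×
          (((A.power m).tensor (B.power m)).tensor ((A.power n).tensor (B.power n))) =>
          (Fin.appendEquiv m n z.1, Fin.appendEquiv m n (z.2.1.1, z.2.2.1),
            Fin.appendEquiv m n (z.2.1.2, z.2.2.2)))
        (fun z => (Fin.appendEquiv m n z.1, Fin.appendEquiv m n (z.2.1.1, z.2.2.1),
            Fin.appendEquiv m n (z.2.1.2, z.2.2.2))) =
      tensorState (groupCAB (copies ω m)) (groupCAB (copies ω n)) := by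
  ext p q
  simp [groupCAB, copies, tensorState, Fin.prod_univ_add, Fin.appendEquiv]

lemma add_mem_measuredDeficits {A C B : QSystem} {ω : Matrix (A × C × B) (A × C × B) ℂ} {m n : ℕ}
    (hm : IsDensity (copies ω m)) (hn : IsDensity (copies ω n)) {v w : ℝ}
    (hv : v ∈ measuredDeficits (copies ω m)) (hw : w ∈ measuredDeficits (copies ω n)) :
    v + w ∈ measuredDeficits (copies ω (m + n)) := by
  obtain ⟨X₁, Y₁, Φ, hΦ, rfl⟩ := hv
  obtain ⟨X₂, Y₂, Ψ, hΨ, rfl⟩ := hw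
  obtain ⟨Θ, hΘ, hΘ'⟩ := hΦ.exists_tensor hΨ
  have hsplit := (CLODCC₂.id (X := C.power (m + n))
    (Y := (A.power (m + n)).tensor (B.power (m + n)))).relabelX
      (X'' := (C.power m).tensor (C.power n)) (Fin.appendEquiv m n) |>.relabelY
      (Y'' := ((A.power m).tensor (B.power m)).tensor ((A.power n).tensor (B.power n)))
      ((Equiv.prodProdProdComm _ _ _ _).trans
        (Equiv.prodCongr (Fin.appendEquiv m n) (Fin.appendEquiv m n)))
  refine ⟨_, _, _, hsplit.comp hΘ, ?_⟩
  have : Θ (tensorState (groupCAB (copies ω m)) (groupCAB (copies ω n))) = _ := hΘ' _ _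
  rw [← submatrix_groupCAB_copies] at this
  refine Eq.trans ?_ (congrArg (fun M => entropyDeficit (readout M)) this.symm)
  refine (entropyDeficit_prod ((Equiv.prodComm _ _).trans (Equiv.prodProdProdComm _ _ _ _))
    (readout_mem_stdSimplex (hΦ.isDensity hm.groupCAB))
    (readout_mem_stdSimplex (hΨ.isDensity hn.groupCAB)) fun x y => ?_).symm
  -- Diagonal entries of a positive operator are real, so the real part of the product factorises.
  have hx : (Φ (groupCAB (copies ω m)) x x).im = 0 :=
    (Complex.le_def.1 (hΦ.posSemidef hm.groupCAB.1).diag_nonneg).2.symm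
  change (_ * _ : ℂ).re = _
  rw [Complex.mul_re]
  erw [hx]
  rw [mul_zero, sub_zero, mul_comm]
  rfl

lemma IsDensity.copies {A C B : QSystem} {ω : Matrix (A × C × B) (A × C × B) ℂ}
    (hω : IsDensity ω) (n : ℕ) : IsDensity (copies ω n) := by
  let e : (A.power n × C.power n × B.power n) ≃ (Fin n → A × C × B) :=
    ⟨fun x k => (x.1 k, x.2.1 k, x.2.2 k), fun f => (fun k => (f k).1, fun k => (f k).2.1,
      fun k => (f k).2.2), fun _ => rfl, fun _ => rfl⟩
  refine IsDensity.submatrix_equiv (M := Matrix.of fun f g => ∏ k, ω (f k) (g k)) ⟨?_, ?_⟩ e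
  · obtain ⟨m, T, hT⟩ := Matrix.posSemidef_iff_eq_sum_vecMulVec.1 hω.1
    -- With `ω` a sum of `m` rank-one terms, the power is `K * Kᴴ`, where a column of `K` chooses
    -- one term for each copy.
    convert Matrix.posSemidef_self_mul_conjTranspose
      (Matrix.of fun (f : Fin n → A × C × B) (g : Fin n → Fin m) => ∏ k, T (g k) (f k)) using 1
    ext f g
    simp only [hT, Matrix.of_apply, Matrix.mul_apply, Matrix.conjTranspose_apply,
      Matrix.sum_apply, Matrix.vecMulVec_apply, Pi.star_apply,
      Finset.prod_univ_sum, Fintype.piFinset_univ, star_prod, Finset.prod_mul_distrib]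
  · have := hω.2
    simp only [Matrix.trace, Matrix.diag_apply, Matrix.of_apply] at this ⊢
    rw [← Fintype.piFinset_univ, ← Finset.prod_univ_sum (fun _ => Finset.univ)
      (fun _ x => ω x x), this, Finset.prod_const_one]

lemma IsDensity.jointState {A C₁ C₂ B : QSystem} {ρ : Matrix (A × C₁) (A × C₁) ℂ}
    {ρt : Matrix (C₂ × B) (C₂ × B) ℂ} (hρ : IsDensity ρ) (hρt : IsDensity ρt) :
    IsDensity (jointState ρ ρt) := by
  let e : (A × (C₁.tensor C₂) × B) ≃ (A × C₁) × (C₂ × B) :=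
    ⟨fun x => ((x.1, x.2.1.1), (x.2.1.2, x.2.2)), fun x => (x.1.1, (x.1.2, x.2.1), x.2.2),
      fun _ => rfl, fun _ => rfl⟩
  refine IsDensity.submatrix_equiv (M := ρ ⊗ₖ ρt) ⟨hρ.1.kronecker hρt.1, ?_⟩ e
  rw [Matrix.trace_kronecker, hρ.2, hρt.2, one_mul]

/-- The measured relative entropy of `n` copies, as a real number. -/
def copiesDeficit {A C B : QSystem} (ω : Matrix (A × C × B) (A × C × B) ℂ) (n : ℕ) : ℝ :=
  sSup (measuredDeficits (copies ω n))

/-! ### Superadditivity and existence of the limit -/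

section

variable {A C B : QSystem} {ω : Matrix (A × C × B) (A × C × B) ℂ}

lemma scaledMeasuredRelEntropy_eq (hω : IsDensity ω) (n : ℕ) :
    scaledMeasuredRelEntropy ω n = ((copiesDeficit ω n / n : ℝ) : EReal) := by
  rw [scaledMeasuredRelEntropy, measuredRelEntropy_eq (hω.copies n), ← EReal.coe_mul,
    copiesDeficit, one_div_mul_eq_div]

lemma subadditive_neg_copiesDeficit (hω : IsDensity ω) :
    Subadditive fun n => -copiesDeficit ω n := fun m n => by
  have : copiesDeficit ω m + copiesDeficit ω n ≤ copiesDeficit ω (m + n) := by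
    rw [← le_sub_iff_add_le]
    refine csSup_le measuredDeficits_nonempty fun v hv => ?_
    rw [le_sub_comm]
    refine csSup_le measuredDeficits_nonempty fun w hw => ?_
    rw [le_sub_iff_add_le']
    exact le_csSup (bddAbove_measuredDeficits (hω.copies _))
      (add_mem_measuredDeficits (hω.copies _) (hω.copies _) hv hw)
  linarith

lemma copiesDeficit_div_le (hω : IsDensity ω) (n : ℕ) :
    copiesDeficit ω n / n ≤ Real.logb 2 (Fintype.card (C × A × B)) := by
  -- Nonnegativity of the bound covers `n = 0`, where the quotient is `0` by convention.
  have h0 : 0 ≤ Real.logb 2 (Fintype.card (C × A × B)) := by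
    rcases Nat.eq_zero_or_pos (Fintype.card (C × A × B)) with h | h
    · simp [h]
    · exact Real.logb_nonneg one_lt_two (by exact_mod_cast h)
  refine div_le_of_le_mul₀ n.cast_nonneg h0 ?_
  refine csSup_le measuredDeficits_nonempty fun v hv => ?_
  refine (le_of_mem_measuredDeficits (hω.copies n) hv).trans_eq ?_
  rw [mul_comm, ← Real.logb_pow]
  simp [mul_pow]

lemma exists_tendsto_copiesDeficit_div (hω : IsDensity ω) :
    ∃ l : ℝ, Tendsto (fun n : ℕ => copiesDeficit ω n / n) atTop (𝓝 l) := by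
  have h := subadditive_neg_copiesDeficit hω
  refine ⟨-h.lim, ?_⟩
  have := h.tendsto_lim ⟨-Real.logb 2 (Fintype.card (C × A × B)), ?_⟩
  · simpa [neg_div] using this.neg
  · rintro _ ⟨n, rfl⟩
    have := copiesDeficit_div_le hω n
    simp only [neg_div]
    linarith

end

/-! ### The trace norm bounds differences of probabilities -/

lemma sum_norm_sq_eq_conjTranspose_mul_self {X Y : Type} [Fintype X] (T : Matrix X Y ℂ) (i : Y) :
    ∑ y, ‖T y i‖ ^ 2 = ((Tᴴ * T) i i).re := by
  simp only [Matrix.mul_apply, Matrix.conjTranspose_apply, Complex.re_sum]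
  refine Finset.sum_congr rfl fun y _ => ?_
  rw [Complex.star_def, ← Complex.normSq_eq_conj_mul_self, Complex.ofReal_re,
    Complex.normSq_eq_norm_sq]

/-- Let `V` diagonalise `Mᴴ * M`. Then `U M Uᴴ = (U M V)(U V)ᴴ`, where the columns of `U M V` have
the singular values as norms and those of `U V` are unit vectors; apply Cauchy–Schwarz column by
column. -/
lemma norm_sum_diag_conjBy_le_traceNorm {Y Z : Type} [Fintype Y] [DecidableEq Y] [Fintype Z]
    {U : Matrix Z Y ℂ} (hU : Uᴴ * U = 1) (s : Finset Z) (M : Matrix Y Y ℂ) :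
    ‖∑ z ∈ s, conjBy U M z z‖ ≤ traceNorm M := by
  have hA := Matrix.isHermitian_conjTranspose_mul_self M
  let V : Matrix Y Y ℂ := hA.eigenvectorUnitary
  have hV : V * Vᴴ = 1 := Unitary.mul_star_self_of_mem hA.eigenvectorUnitary.2
  have hV' : Vᴴ * V = 1 := Unitary.star_mul_self_of_mem hA.eigenvectorUnitary.2
  have hconj : conjBy U M = (U * M * V) * (U * V)ᴴ := by
    rw [Matrix.conjTranspose_mul, ← Matrix.mul_assoc, Matrix.mul_assoc (U * M), hV,
      Matrix.mul_one, conjBy]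
  have hR : ∀ i, ∑ z, ‖(U * V) z i‖ ^ 2 = 1 := fun i => by
    rw [sum_norm_sq_eq_conjTranspose_mul_self, Matrix.conjTranspose_mul, Matrix.mul_assoc,
      ← Matrix.mul_assoc Uᴴ, hU, Matrix.one_mul, hV']
    simp
  have hT : ∀ i, ∑ z, ‖(U * M * V) z i‖ ^ 2 = hA.eigenvalues i := fun i => by
    have : (U * M * V)ᴴ * (U * M * V) = Vᴴ * ((Mᴴ * M) * V) := by
      rw [Matrix.conjTranspose_mul, Matrix.conjTranspose_mul]
      simp only [Matrix.mul_assoc]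
      rw [← Matrix.mul_assoc Uᴴ, hU, Matrix.one_mul]
    rw [sum_norm_sq_eq_conjTranspose_mul_self, this, hA.eigenvalues_eq]
    rfl
  calc ‖∑ z ∈ s, conjBy U M z z‖
      = ‖∑ i, ∑ z ∈ s, (U * M * V) z i * star ((U * V) z i)‖ := by
        rw [hconj, Finset.sum_comm]
        simp only [Matrix.mul_apply (N := (U * V)ᴴ), Matrix.conjTranspose_apply]
    _ ≤ ∑ i, ∑ z ∈ s, ‖(U * M * V) z i‖ * ‖(U * V) z i‖ := by
        refine norm_sum_le_of_le _ fun i _ => norm_sum_le_of_le _ fun z _ => ?_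
        rw [norm_mul, norm_star]
    _ ≤ ∑ i, √(hA.eigenvalues i) := by
        refine Finset.sum_le_sum fun i _ => ?_
        refine (Real.sum_mul_le_sqrt_mul_sqrt _ _ _).trans ?_
        rw [← mul_one √(hA.eigenvalues i), ← hT i]
        gcongr
        · exact s.subset_univ
        · rw [Real.sqrt_le_iff, one_pow]
          refine ⟨zero_le_one, le_of_le_of_eq ?_ (hR i)⟩
          exact Finset.sum_le_sum_of_subset_of_nonneg s.subset_univ fun _ _ _ => sq_nonneg _

/-! ### Reading out the key of a local idit -/

/-- A unitary which maps the uniform superposition to the first basis vector. -/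
lemma exists_unitary_first_row_const {d : ℕ} (hd : 0 < d) :
    ∃ F : Matrix (Fin d) (Fin d) ℂ, F * Fᴴ = 1 ∧ ∀ i, F ⟨0, hd⟩ i = ((√d)⁻¹ : ℝ) := by
  let u : EuclideanSpace ℂ (Fin d) := WithLp.toLp 2 fun _ => (((√d)⁻¹ : ℝ) : ℂ)
  have hd' : (0 : ℝ) < d := by exact_mod_cast hd
  have hu : ‖u‖ = 1 := by
    rw [EuclideanSpace.norm_eq, Real.sqrt_eq_one]
    simp [u, abs_of_nonneg, Real.sqrt_nonneg, hd'.ne']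
  obtain ⟨b, hb⟩ := Orthonormal.exists_orthonormalBasis_extension_of_card_eq (𝕜 := ℂ)
    (ι := Fin d) (v := fun _ => u) (s := {⟨0, hd⟩}) (by simp)
    ⟨fun _ => hu, fun i j hij => (hij (Subsingleton.elim _ _)).elim⟩
  refine ⟨Matrix.of fun j i => star (b j i), ?_, fun i => ?_⟩
  · ext j k
    have := orthonormal_iff_ite.1 b.orthonormal j k
    rw [Matrix.one_apply, ← RCLike.ofReal_one]
    simpa [PiLp.inner_apply, Matrix.mul_apply, mul_comm] using this
  · simp [hb ⟨0, hd⟩ rfl, u]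

section

variable {d : ℕ} {A' B' : QSystem}

/-- Untwisting of the controlled unitary `∑ᵢ |i⟩⟨i| ⊗ Uᵢ`, followed by `F` on the key. -/
def untwist (F : Matrix (Fin d) (Fin d) ℂ) (U : Fin d → Matrix.unitaryGroup (A' × B') ℂ) :
    Matrix (Fin d × (A' × B')) ((Fin d × A') × B') ℂ :=
  Matrix.of fun z y => F z.1 y.1.1 *
    (U y.1.1 : Matrix (A' × B') (A' × B') ℂ)ᴴ z.2 (y.1.2, y.2)

lemma isUnitaryBetween_untwist {F : Matrix (Fin d) (Fin d) ℂ} (hF : F * Fᴴ = 1)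
    (U : Fin d → Matrix.unitaryGroup (A' × B') ℂ) :
    IsUnitaryBetween (A := ((QSystem.qudit d).tensor A').tensor B')
      (A' := (QSystem.qudit d).tensor (A'.tensor B')) (untwist F U) := by
  have h : untwist F U * (untwist F U)ᴴ = 1 := by
    ext ⟨i, p⟩ ⟨j, q⟩
    have hU : ∀ k, ∑ a, ∑ b, (U k : Matrix (A' × B') (A' × B') ℂ)ᴴ p (a, b) *
        (U k : Matrix (A' × B') (A' × B') ℂ) (a, b) q = (1 : Matrix (A' × B') (A' × B') ℂ) p q :=
      fun k => by
        rw [← Unitary.star_mul_self_of_mem (U k).2, Matrix.mul_apply, Fintype.sum_prod_type]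
        rfl
    calc (untwist F U * (untwist F U)ᴴ) (i, p) (j, q)
        = ∑ k, F i k * star (F j k) * ∑ a, ∑ b, (U k : Matrix (A' × B') (A' × B') ℂ)ᴴ p (a, b) *
            (U k : Matrix (A' × B') (A' × B') ℂ) (a, b) q := by
          simp only [untwist, Matrix.mul_apply, Fintype.sum_prod_type, Matrix.conjTranspose_apply,
            Matrix.of_apply, star_mul', star_star, Finset.mul_sum]
          refine Finset.sum_congr rfl fun k _ => Finset.sum_congr rfl fun a _ =>
            Finset.sum_congr rfl fun b _ => ?_
          ring
      _ = (F * Fᴴ) i j * (1 : Matrix (A' × B') (A' × B') ℂ) p q := by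
          simp_rw [hU, ← Finset.sum_mul]
          rfl
      _ = _ := by
          rw [hF]
          simp only [Matrix.one_apply, Prod.mk.injEq]
          split_ifs <;> simp_all
  -- Both index types have the same cardinality, so a right inverse is also a left inverse.
  exact ⟨(Matrix.mul_eq_one_comm_of_card_eq _ _ _ (by
    simp only [Fintype.card_prod, mul_assoc])).1 h, h⟩

/-- Untwisting leaves `F |+⟩⟨+| Fᴴ ⊗ σ`, and row zero of `F` is the bra of `|+⟩`, so the corner
block is `σ` itself. -/
lemma conjBy_untwist_localIdit (hd : 0 < d) {F : Matrix (Fin d) (Fin d) ℂ}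
    (hF : ∀ i, F ⟨0, hd⟩ i = ((√d)⁻¹ : ℝ)) (U : Fin d → Matrix.unitaryGroup (A' × B') ℂ)
    (σ : Matrix (A' × B') (A' × B') ℂ) (p q : A' × B') :
    conjBy (untwist F U) (localIdit d σ U) (⟨0, hd⟩, p) (⟨0, hd⟩, q) = σ p q := by
  have hd' : (d : ℂ) ≠ 0 := by exact_mod_cast hd.ne'
  have hsq : (((√d)⁻¹ : ℝ) : ℂ) * (((√d)⁻¹ : ℝ) : ℂ) = (d : ℂ)⁻¹ := by
    rw [← Complex.ofReal_mul, ← mul_inv, Real.mul_self_sqrt d.cast_nonneg]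
    simp
  have hstar : star (((√d)⁻¹ : ℝ) : ℂ) = ((√d)⁻¹ : ℝ) := Complex.conj_ofReal _
  have hleft : ∀ y, (untwist F U * localIdit d σ U) (⟨0, hd⟩, p) y =
      ((√d)⁻¹ : ℝ) * (σ * (U y.1.1 : Matrix (A' × B') (A' × B') ℂ)ᴴ) p (y.1.2, y.2) := fun y => by
    have hU : ∀ k, ∑ a, ∑ b, (U k : Matrix (A' × B') (A' × B') ℂ)ᴴ p (a, b) *
        ((U k : Matrix (A' × B') (A' × B') ℂ) * σ *
          (U y.1.1 : Matrix (A' × B') (A' × B') ℂ)ᴴ) (a, b) (y.1.2, y.2) =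
        (σ * (U y.1.1 : Matrix (A' × B') (A' × B') ℂ)ᴴ) p (y.1.2, y.2) := fun k => by
      have h1 : (U k : Matrix (A' × B') (A' × B') ℂ)ᴴ * (U k : Matrix (A' × B') (A' × B') ℂ) = 1 :=
        Unitary.star_mul_self_of_mem (U k).2
      rw [← Matrix.one_mul (σ * _), ← h1, Matrix.mul_assoc _ _ (σ * _), Matrix.mul_apply,
        Fintype.sum_prod_type]
      simp only [Matrix.mul_assoc]
    calc (untwist F U * localIdit d σ U) (⟨0, hd⟩, p) y
        = ∑ k : Fin d, ((√d)⁻¹ : ℝ) * (d : ℂ)⁻¹ *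
            ∑ a, ∑ b, (U k : Matrix (A' × B') (A' × B') ℂ)ᴴ p (a, b) *
            ((U k : Matrix (A' × B') (A' × B') ℂ) * σ *
              (U y.1.1 : Matrix (A' × B') (A' × B') ℂ)ᴴ) (a, b) (y.1.2, y.2) := by
          rw [Matrix.mul_apply]
          simp only [untwist, localIdit, Fintype.sum_prod_type, Matrix.of_apply, hF,
            Finset.mul_sum]
          refine Finset.sum_congr rfl fun k _ => Finset.sum_congr rfl fun a _ =>
            Finset.sum_congr rfl fun b _ => ?_
          ring
      _ = _ := by
          simp_rw [hU, Finset.sum_const, Finset.card_univ, Fintype.card_fin, nsmul_eq_mul]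
          field_simp
  have hU : ∀ k, ∑ a, ∑ b, (σ * (U k : Matrix (A' × B') (A' × B') ℂ)ᴴ) p (a, b) *
      (U k : Matrix (A' × B') (A' × B') ℂ) (a, b) q = σ p q := fun k => by
    have h1 : (U k : Matrix (A' × B') (A' × B') ℂ)ᴴ * (U k : Matrix (A' × B') (A' × B') ℂ) = 1 :=
      Unitary.star_mul_self_of_mem (U k).2
    conv_rhs => rw [← Matrix.mul_one σ, ← h1, ← Matrix.mul_assoc, Matrix.mul_apply,
      Fintype.sum_prod_type]
  calc conjBy (untwist F U) (localIdit d σ U) (⟨0, hd⟩, p) (⟨0, hd⟩, q)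
      = ∑ k : Fin d, (d : ℂ)⁻¹ * ∑ a, ∑ b, (σ * (U k : Matrix (A' × B') (A' × B') ℂ)ᴴ) p (a, b) *
          (U k : Matrix (A' × B') (A' × B') ℂ) (a, b) q := by
        rw [conjBy, Matrix.mul_apply]
        simp only [hleft]
        simp only [untwist, Fintype.sum_prod_type, Matrix.conjTranspose_apply,
          Matrix.of_apply, hF, star_mul', star_star, Finset.mul_sum, ← hsq, hstar]
        refine Finset.sum_congr rfl fun k _ => Finset.sum_congr rfl fun a _ =>
          Finset.sum_congr rfl fun b _ => ?_
        ring
    _ = σ p q := by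
        simp_rw [hU, Finset.sum_const, Finset.card_univ, Fintype.card_fin, nsmul_eq_mul]
        field_simp

/-- An operation on `AB` alone commutes with the partial trace over `C`; closeness of the reduced
state thus controls the readout of the full state. -/
lemma sum_conjBy_groupCAB {A C B : QSystem} {Z : Type} (V : Matrix Z (A.tensor B) ℂ)
    (N : Matrix (A × C × B) (A × C × B) ℂ) (z w : Z) :
    ∑ c, conjBy ((1 : Matrix C C ℂ) ⊗ₖ V) (groupCAB N) (c, z) (c, w) =
      conjBy V (traceC N) z w := by
  simp only [conjBy_one_kronecker_apply]
  simp only [groupCAB, traceC, conjBy, Matrix.mul_apply,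
    Matrix.of_apply, Matrix.conjTranspose_apply, Finset.mul_sum, Finset.sum_mul]
  rw [Finset.sum_comm]
  refine Finset.sum_congr rfl fun b _ => ?_
  exact Finset.sum_comm

/-- An operator close to a local idit yields an almost deterministic key readout. -/
lemma one_sub_le_re_sum_conjBy_untwist (hd : 0 < d) {F : Matrix (Fin d) (Fin d) ℂ}
    (hF : F * Fᴴ = 1) (hF0 : ∀ i, F ⟨0, hd⟩ i = ((√d)⁻¹ : ℝ))
    {σ : Matrix (A' × B') (A' × B') ℂ} (hσ : IsDensity σ)
    (U : Fin d → Matrix.unitaryGroup (A' × B') ℂ) {ε : ℝ}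
    {M : Matrix ((Fin d × A') × B') ((Fin d × A') × B') ℂ}
    (hε : traceNorm (M - localIdit d σ U) ≤ ε) :
    1 - ε ≤ (∑ z ∈ {⟨0, hd⟩} ×ˢ (Finset.univ : Finset (A' × B')),
      conjBy (untwist F U) M z z).re := by
  have hidit : ∑ z ∈ {⟨0, hd⟩} ×ˢ (Finset.univ : Finset (A' × B')),
      conjBy (untwist F U) (localIdit d σ U) z z = 1 := by
    rw [Finset.sum_product, Finset.sum_singleton, ← hσ.2]
    exact Finset.sum_congr rfl fun p _ => conjBy_untwist_localIdit hd hF0 U σ p p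
  have hdiff : conjBy (untwist F U) (M - localIdit d σ U) =
      conjBy (untwist F U) M - conjBy (untwist F U) (localIdit d σ U) := by
    simp only [conjBy, Matrix.mul_sub, Matrix.sub_mul]
  have hle := (norm_sum_diag_conjBy_le_traceNorm (isUnitaryBetween_untwist hF U).1
    ({⟨0, hd⟩} ×ˢ Finset.univ) (M - localIdit d σ U)).trans hε
  rw [hdiff] at hle
  simp only [Matrix.sub_apply, Finset.sum_sub_distrib] at hle
  rw [hidit] at hle
  have hre := (abs_le.1 ((Complex.abs_re_le_norm _).trans hle)).1
  rw [Complex.sub_re, Complex.one_re] at hre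
  linarith

lemma logb_le_of_traceNorm_le {A C B C' : QSystem} {ω : Matrix (A × C × B) (A × C × B) ℂ}
    (hω : IsDensity ω) (hd : 1 ≤ d)
    {Φ : Matrix (A × C × B) (A × C × B) ℂ →
      Matrix (((QSystem.qudit d).tensor A') × C' × B') (((QSystem.qudit d).tensor A') × C' × B') ℂ}
    (hΦ : CLODCC₃ A C B ((QSystem.qudit d).tensor A') C' B' Φ)
    {σ : Matrix (A' × B') (A' × B') ℂ} (hσ : IsDensity σ)
    (U : Fin d → Matrix.unitaryGroup (A' × B') ℂ) {ε : ℝ}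
    (hε : traceNorm (traceC (Φ ω) - localIdit d σ U) ≤ ε) :
    (1 - ε) * Real.logb 2 d - 1 ≤ sSup (measuredDeficits ω) := by
  obtain ⟨F, hF, hF0⟩ := exists_unitary_first_row_const hd
  have hΨ := hΦ.toCLODCC₂.unitaryY _ (isUnitaryBetween_untwist hF U)
  have hp := readout_mem_stdSimplex (hΨ.isDensity hω.groupCAB)
  have hmem := le_csSup (bddAbove_measuredDeficits hω) ⟨_, _, _, hΨ, rfl⟩
  refine le_trans ?_ hmem
  let t : Finset (Fin d × (A' × B')) := {⟨0, hd⟩} ×ˢ Finset.univ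
  -- The event fixes the key and leaves `C'`, `A'` and `B'` free, so it contains exactly a fraction
  -- `1 / d` of all outcomes.
  refine le_trans ?_ (sum_mul_logb_sub_one_le_entropyDeficit hp (Finset.univ ×ˢ t) hd ?_)
  · refine sub_le_sub_right (mul_le_mul_of_nonneg_right ?_
      (Real.logb_nonneg one_lt_two (by exact_mod_cast hd))) 1
    refine (one_sub_le_re_sum_conjBy_untwist hd hF hF0 hσ U hε).trans_eq ?_
    rw [Complex.re_sum]
    refine Eq.trans ?_ (Finset.sum_product_right Finset.univ t _).symm
    refine Finset.sum_congr rfl fun z _ => ?_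
    have h := congrArg Complex.re (sum_conjBy_groupCAB (untwist F U) (Φ ω) z z)
    rw [Complex.re_sum] at h
    exact h.symm
  · simp only [t, Fintype.card_prod, Finset.card_product, Finset.card_univ, Fintype.card_fin,
      Finset.card_singleton]
    ring

end

/-! ### The rate bound -/

lemma achievableRates_le {A C B : QSystem} {ω : Matrix (A × C × B) (A × C × B) ℂ}
    (hω : IsDensity ω) {ε : ℝ} (hε : ε < 1) (n : ℕ) :
    sSup (achievableRates ω ε n) ≤
      (((copiesDeficit ω n / n + 1 / n) / (1 - ε) : ℝ) : EReal) := by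
  refine sSup_le ?_
  rintro _ ⟨d, A', C', B', Φ, σ, U, hd, hΦ, hσ, hle, rfl⟩
  have := logb_le_of_traceNorm_le (hω.copies n) hd hΦ hσ U hle
  rw [EReal.coe_le_coe_iff, le_div_iff₀ (by linarith), ← add_div, div_mul_eq_mul_div]
  refine div_le_div_of_nonneg_right ?_ n.cast_nonneg
  rw [copiesDeficit]
  linarith

lemma repeaterRate_le {A C B : QSystem} {ω : Matrix (A × C × B) (A × C × B) ℂ}
    (hω : IsDensity ω) {l : ℝ} (hl : Tendsto (fun n : ℕ => copiesDeficit ω n / n) atTop (𝓝 l)) :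
    repeaterRate ω ≤ l := by
  -- The infimum over `ε` is at most each of its terms. In each term the additive loss of one bit
  -- vanishes after division by `n`, and only the factor `1 / (1 - ε)` remains.
  have hbound : ∀ ε : ℝ, 0 < ε → ε < 1 → repeaterRate ω ≤ ((l / (1 - ε) : ℝ) : EReal) := by
    intro ε h0 h1
    refine (iInf₂_le ε h0).trans ?_
    refine (limsup_le_limsup (Eventually.of_forall fun n => achievableRates_le hω h1 n)).trans_eq ?_
    refine Tendsto.limsup_eq ?_
    refine (continuous_coe_real_ereal.tendsto _).comp ?_
    have := (hl.add tendsto_one_div_atTop_nhds_zero_nat).div_const (1 - ε)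
    rwa [add_zero] at this
  have hlim : Tendsto (fun ε : ℝ => ((l / (1 - ε) : ℝ) : EReal)) (𝓝[>] 0) (𝓝 (l : EReal)) := by
    refine (continuous_coe_real_ereal.tendsto _).comp ?_
    have : ContinuousAt (fun ε : ℝ => l / (1 - ε)) 0 :=
      continuousAt_const.div (continuousAt_const.sub continuousAt_id) (by simp)
    simpa using this.tendsto.mono_left nhdsWithin_le_nhds
  refine ge_of_tendsto hlim ?_
  filter_upwards [Ioo_mem_nhdsGT (zero_lt_one' ℝ)] with ε hε
  exact hbound ε hε.1 hε.2

theorem mainTheorem2 (A C₁ C₂ B : QSystem)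
    (ρ : Matrix (A × C₁) (A × C₁) ℂ) (ρt : Matrix (C₂ × B) (C₂ × B) ℂ)
    (hρ : IsDensity ρ) (hρt : IsDensity ρt) :
    Tendsto (scaledMeasuredRelEntropy (jointState ρ ρt)) atTop
      (𝓝 (regularisedMeasuredRelEntropy (jointState ρ ρt))) ∧
    repeaterRate (jointState ρ ρt) ≤ regularisedMeasuredRelEntropy (jointState ρ ρt) := by
  have hω := hρ.jointState hρt
  obtain ⟨l, hl⟩ := exists_tendsto_copiesDeficit_div hω
  have hlim : Tendsto (scaledMeasuredRelEntropy (jointState ρ ρt)) atTop (𝓝 (l : EReal)) := by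
    rw [funext (scaledMeasuredRelEntropy_eq hω)]
    exact (continuous_coe_real_ereal.tendsto _).comp hl
  have hreg : regularisedMeasuredRelEntropy (jointState ρ ρt) = l := hlim.liminf_eq
  rw [hreg]
  exact ⟨hlim, repeaterRate_le hω hl⟩

end
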